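/- Let $0\le m<n$ be integers. Let $\mathrm{Hom}_+(k,d)$ denote the set of real homogeneous polynomials of degree $d$ in $k$ variables with nonnegative coefficients, let $e_1,\dots,e_n$ be the standard basis of $\mathbb{R}^n$, and let $e=(1,\dots,1)=e_1+\dots+e_n$. A homogeneous polynomial $q$ of degree $n$ in $n$ real variables is called POS-hyperbolic if $q(e)>0$; for every $X\in\mathbb{R}^n$ the univariate polynomial $t\mapsto q(X-te)$ has exactly $n$ real roots, counted with multiplicity; and all these roots are nonnegative whenever all coordinates of $X$ are nonnegative. For such $q$ and $X\in\mathbb{R}^n$, $\mathrm{Rank}_q(X)$ is the number of nonzero roots, counted with multiplicity, of $q(X-te)=0$ in $t$. **Theorem D.1.** Let $q\in\mathrm{Hom}_+(n,n)$ be POS-hyperbolic. Suppose that the infimum $$\mathrm{Cap}(q)=\inf\Big\{\,q(x_1,\dots,x_n)\;:\;x_1,\dots,x_n>0,\ \prod_{i=1}^n x_i=1\Big\}$$ is attained, and that $\mathrm{Rank}_q(e_1+\dots+e_m)=m$. Then there are $q_1\in\mathrm{Hom}_+(m,m)$ and $q_2\in\mathrm{Hom}_+(n-m,n-m)$ such that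 $$q(x_1,\dots,x_n)=q_1(x_1,\dots,x_m)\,q_2(x_{m+1},\dots,x_n).$$ -/

import Mathlib

noncomputable section

namespace HyperbolicPoly

/-- `Hom(m, d)`: real homogeneous polynomials of degree `d` in `m` variables. -/
def Hom (m d : ℕ) : Set (MvPolynomial (Fin m) ℝ) :=
  {p | p.IsHomogeneous d}

/-- `Hom_+(m, d)`: the elements of `Hom(m, d)` with nonnegative coefficients. -/
def HomPlus (m d : ℕ) : Set (MvPolynomial (Fin m) ℝ) :=
  {p | p ∈ Hom m d ∧ ∀ r : Fin m →₀ ℕ, 0 ≤ MvPolynomial.coeff r p}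

/-- The univariate real polynomial `p(x - t e)` in the indeterminate `t`. -/
def onLine {m : ℕ} (p : MvPolynomial (Fin m) ℝ) (e x : Fin m → ℝ) : Polynomial ℝ :=
  MvPolynomial.aeval (fun i => Polynomial.C (x i) - Polynomial.X * Polynomial.C (e i)) p

/-- The multiset of real roots of `p(x - t e)`, with multiplicity. -/
def eigenvalues {m : ℕ} (p : MvPolynomial (Fin m) ℝ) (e x : Fin m → ℝ) : Multiset ℝ :=
  (onLine p e x).roots

/-- `p` is a homogeneous polynomial of degree `d`, hyperbolic in the direction `e`: `p(e) ≠ 0`,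
and for every real vector `x` the polynomial `p(x - t e)` has exactly `d` real roots, counted
with multiplicity. -/
def IsHyperbolic {m : ℕ} (d : ℕ) (p : MvPolynomial (Fin m) ℝ) (e : Fin m → ℝ) : Prop :=
  p ∈ Hom m d ∧ MvPolynomial.eval e p ≠ 0 ∧
    ∀ x : Fin m → ℝ, Multiset.card (eigenvalues p e x) = d

/-- `N_e(p)`: the vectors `x` such that all roots of `p(x - t e)` are nonnegative. -/
def nonnegCone {m : ℕ} (p : MvPolynomial (Fin m) ℝ) (e : Fin m → ℝ) : Set (Fin m → ℝ) :=
  {x | ∀ t ∈ eigenvalues p e x, 0 ≤ t}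

/-- `p` is POS-hyperbolic of degree `d`: with `e = (1, …, 1)`, one has `p(e) > 0`, `p` is
`e`-hyperbolic, and `N_e(p)` contains the nonnegative orthant. -/
def IsPOSHyperbolic {m : ℕ} (d : ℕ) (p : MvPolynomial (Fin m) ℝ) : Prop :=
  0 < MvPolynomial.eval (fun _ => (1 : ℝ)) p ∧
    IsHyperbolic d p (fun _ => 1) ∧
    ∀ x : Fin m → ℝ, (∀ i, 0 ≤ x i) → x ∈ nonnegCone p (fun _ => 1)

/-- `Rank_p(x)`: the number of nonzero roots, counted with multiplicity, of `p(x - t e)`,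
where `e = (1, …, 1)`. -/
def rank {m : ℕ} (p : MvPolynomial (Fin m) ℝ) (x : Fin m → ℝ) : ℕ :=
  Multiset.card ((eigenvalues p (fun _ => 1) x).filter (fun t => t ≠ 0))

/-- The vectors with positive coordinates whose product is `1`. -/
def capDomain (m : ℕ) : Set (Fin m → ℝ) :=
  {x | (∀ i, 0 < x i) ∧ ∏ i, x i = 1}

/-- The capacity of `p`: the infimum of `p` over `capDomain m`. -/
def cap {m : ℕ} (p : MvPolynomial (Fin m) ℝ) : ℝ :=
  sInf ((fun x => MvPolynomial.eval x p) '' capDomain m)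

/-- The infimum that defines the capacity is attained. -/
def CapAttained {m : ℕ} (p : MvPolynomial (Fin m) ℝ) : Prop :=
  ∃ x ∈ capDomain m, MvPolynomial.eval x p = cap p

/-- The vector `e_1 + ⋯ + e_m` in `ℝⁿ`. -/
def firstBasisSum (n m : ℕ) : Fin n → ℝ :=
  ∑ i ∈ Finset.univ.filter (fun i : Fin n => i.val < m), Pi.single i (1 : ℝ)

/-- `p(x_1, …, x_m)` as a polynomial in `x_1, …, x_n`. -/
def inFirstVars {n m : ℕ} (h : m < n) (p : MvPolynomial (Fin m) ℝ) : MvPolynomial (Fin n) ℝ :=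
  MvPolynomial.rename (fun i : Fin m => (⟨i.val, i.isLt.trans h⟩ : Fin n)) p

/-- `p(x_{m+1}, …, x_n)` as a polynomial in `x_1, …, x_n`. -/
def inLastVars {n m : ℕ} (h : m < n) (p : MvPolynomial (Fin (n - m)) ℝ) :
    MvPolynomial (Fin n) ℝ :=
  MvPolynomial.rename
    (fun j : Fin (n - m) =>
      (⟨m + j.val, (Nat.add_lt_add_left j.isLt m).trans_eq (Nat.add_sub_of_le h.le)⟩ : Fin n)) p

end HyperbolicPoly

end

namespace HyperbolicPoly

open MvPolynomial

/-! The rank condition makes `X ^ (n - m)` divide `q(e_1 + ⋯ + e_m + X e)`. Nonnegative coefficients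
rule out cancellation, so every monomial has degree at most `m` in the first group of variables
(`firstDegree_le_rank`). A monomial of smaller degree would let a rescaling of the two groups go
below the attained capacity (`firstDegree_eq_of_capAttained`). Hence `q` is bihomogeneous.

Bihomogeneity allows the two groups to be scaled separately, so hyperbolicity forbids zeros with
independent nonreal shifts in the two groups. A real-rootedness argument then gives `q(x', x'') q(1,
1) = q(x', 1) q(1, x'')` (`IsBihomogeneous.eval_mul_eval_one`), which is the factorization. -/

/-! ### Bidegrees of monomials, from the rank and the capacity -/

/-- The degree of the monomial `r` in the first `m` variables. -/
def firstDegree {n : ℕ} (m : ℕ) (r : Fin n →₀ ℕ) : ℕ :=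
  ∑ i with i.val < m, r i

/-- The degree of the monomial `r` in the variables after the first `m`. -/
def lastDegree {n : ℕ} (m : ℕ) (r : Fin n →₀ ℕ) : ℕ :=
  ∑ i with ¬ i.val < m, r i

lemma firstDegree_add_lastDegree {n d : ℕ} (m : ℕ) {q : MvPolynomial (Fin n) ℝ}
    (hq : q.IsHomogeneous d) {r : Fin n →₀ ℕ} (hr : coeff r q ≠ 0) :
    firstDegree m r + lastDegree m r = d := by
  rw [firstDegree, lastDegree, Finset.sum_filter_add_sum_filter_not, ← Finsupp.degree_eq_sum,
    Finsupp.degree_eq_weight_one]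
  exact hq hr

lemma prod_ite_pow {R : Type*} [CommMonoid R] {n : ℕ} (m : ℕ) (r : Fin n →₀ ℕ) (a b : R) :
    ∏ i, (if i.val < m then a else b) ^ r i = a ^ firstDegree m r * b ^ lastDegree m r := by
  simp only [ite_pow, Finset.prod_ite, Finset.prod_pow_eq_pow_sum, firstDegree, lastDegree]

/-- If the coefficients of `q` are nonnegative, the degree of `q` in the first `m` variables is
at most the rank of `e_1 + ⋯ + e_m`. -/
lemma firstDegree_le_rank {n m : ℕ} (hmn : m < n) {q : MvPolynomial (Fin n) ℝ}
    (hq : q ∈ HomPlus n n) (hhyp : IsHyperbolic n q (fun _ => 1))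
    (hrank : rank q (firstBasisSum n m) = m) {r : Fin n →₀ ℕ} (hr : coeff r q ≠ 0) :
    firstDegree m r ≤ m := by
  set f := onLine q (fun _ => 1) (firstBasisSum n m) with hf
  have hcard : Multiset.card f.roots = n := hhyp.2.2 _
  have hrk : Multiset.card (f.roots.filter (fun t => t ≠ 0)) = m := hrank
  have hmult : f.rootMultiplicity 0 = n - m := by
    have h1 := congrArg Multiset.card (Multiset.filter_add_not (fun t : ℝ => t ≠ 0) f.roots)
    rw [Multiset.card_add, hcard, hrk] at h1
    have h2 : Multiset.card (f.roots.filter (fun t => ¬ t ≠ 0)) = f.roots.count 0 := by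
      rw [Multiset.count_eq_card_filter_eq]
      congr 1
      refine Multiset.filter_congr fun x _ => ?_
      simp [eq_comm]
    rw [← Polynomial.count_roots, ← h2]
    omega
  have hdvd : Polynomial.X ^ (n - m) ∣ f := by
    simpa [hmult] using Polynomial.pow_rootMultiplicity_dvd f 0
  -- With `t = -X` the argument becomes `e_1 + ⋯ + e_m + X e`, so every summand has nonnegative
  -- coefficients.
  have hcomp : f.comp (-Polynomial.X) =
      ∑ r ∈ q.support, Polynomial.C (coeff r q) *
        ((1 + Polynomial.X) ^ firstDegree m r * Polynomial.X ^ lastDegree m r) := by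
    have h1 : f.comp (-Polynomial.X) = aeval (fun i : Fin n =>
        if i.val < m then (1 + Polynomial.X : Polynomial ℝ) else Polynomial.X) q := by
      have h2 : f.comp (-Polynomial.X) = Polynomial.aeval (-Polynomial.X) f := rfl
      rw [h2, hf, onLine, ← AlgHom.comp_apply, MvPolynomial.comp_aeval]
      congr 2
      funext i
      by_cases hi : i.val < m <;> simp [firstBasisSum, Finset.sum_apply, Pi.single_apply, hi]
    rw [h1, aeval_def, eval₂_eq']
    refine Finset.sum_congr rfl fun r _ => ?_
    rw [prod_ite_pow]
    rfl
  have hdvd' : Polynomial.X ^ (n - m) ∣ f.comp (-Polynomial.X) := by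
    obtain ⟨g, hg⟩ := hdvd
    rw [hg, Polynomial.mul_comp, Polynomial.X_pow_comp, neg_pow]
    exact ⟨(-1) ^ (n - m) * g.comp (-Polynomial.X), by ring⟩
  have hsum := firstDegree_add_lastDegree m hq.1 hr
  by_contra hlt
  -- If `firstDegree m r > m`, then `lastDegree m r < n - m`, so this coefficient vanishes; yet `r`
  -- contributes `coeff r q > 0` to it.
  have h0 := Polynomial.X_pow_dvd_iff.1 hdvd' (lastDegree m r) (by omega)
  rw [hcomp, Polynomial.finsetSum_coeff] at h0
  have hterm : ∀ r' d, 0 ≤ (Polynomial.C (coeff r' q) *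
      ((1 + Polynomial.X) ^ firstDegree m r' * Polynomial.X ^ lastDegree m r')).coeff d := by
    intro r' d
    rw [Polynomial.coeff_C_mul, Polynomial.coeff_mul_X_pow']
    refine mul_nonneg (hq.2 r') ?_
    split_ifs
    · rw [Polynomial.coeff_one_add_X_pow]
      positivity
    · exact le_rfl
  have h1 := (Finset.sum_eq_zero_iff_of_nonneg fun r' _ => hterm r' _).1 h0 r
    (mem_support_iff.2 hr)
  rw [Polynomial.coeff_C_mul, Polynomial.coeff_mul_X_pow', if_pos le_rfl, Nat.sub_self,
    Polynomial.coeff_one_add_X_pow] at h1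
  simp [hr] at h1

lemma prod_ite_mul_pow {R : Type*} [CommMonoid R] {n : ℕ} (m : ℕ) (r : Fin n →₀ ℕ) (a b : R)
    (z : Fin n → R) :
    ∏ i, (if i.val < m then a * z i else b * z i) ^ r i =
      a ^ firstDegree m r * b ^ lastDegree m r * ∏ i, z i ^ r i := by
  rw [← prod_ite_pow, ← Finset.prod_mul_distrib]
  refine Finset.prod_congr rfl fun i _ => ?_
  split_ifs <;> exact mul_pow _ _ _

/-- At a minimizer of the capacity, no monomial has degree below `m` in the first `m` variables
if none has degree above `m`. -/
lemma firstDegree_eq_of_capAttained {n m : ℕ} (hmn : m < n) {q : MvPolynomial (Fin n) ℝ}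
    (hq : q ∈ HomPlus n n) (hcap : CapAttained q)
    (hle : ∀ r, coeff r q ≠ 0 → firstDegree m r ≤ m) {r : Fin n →₀ ℕ} (hr : coeff r q ≠ 0) :
    firstDegree m r = m := by
  obtain ⟨x, ⟨hx0, hx1⟩, hx⟩ := hcap
  -- This scaling preserves the product of the coordinates and multiplies a monomial of first degree
  -- `s` by `2 ^ (n (s - m))`.
  set y : Fin n → ℝ := fun i =>
    if i.val < m then 2 ^ (n - m) * x i else (2 ^ m)⁻¹ * x i with hy
  have hy0 : ∀ i, 0 < y i := by
    intro i
    have := hx0 i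
    simp only [hy]
    split_ifs <;> positivity
  have hcardS : (Finset.univ.filter (fun i : Fin n => i.val < m)).card = m := by
    rw [Fin.card_filter_val_lt]; omega
  have hcardT : (Finset.univ.filter (fun i : Fin n => ¬ i.val < m)).card = n - m := by
    have := Finset.card_filter_add_card_filter_not (s := (Finset.univ : Finset (Fin n)))
      (fun i : Fin n => i.val < m)
    rw [hcardS, Finset.card_univ, Fintype.card_fin] at this
    omega
  have hy1 : ∏ i, y i = 1 := by
    have h1 : ∏ i, y i = (∏ i : Fin n, if i.val < m then (2 : ℝ) ^ (n - m) else (2 ^ m)⁻¹) *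
        ∏ i, x i := by
      rw [← Finset.prod_mul_distrib]
      refine Finset.prod_congr rfl fun i _ => ?_
      simp only [hy, ite_mul]
    rw [h1, hx1, mul_one, Finset.prod_ite, Finset.prod_const, Finset.prod_const, hcardS, hcardT,
      inv_pow, ← pow_mul, ← pow_mul, mul_comm m]
    exact mul_inv_cancel₀ (by positivity)
  have hbdd : BddBelow ((fun x => eval x q) '' capDomain n) := by
    refine ⟨0, ?_⟩
    rintro _ ⟨z, hz, rfl⟩
    simp only [eval_eq']
    exact Finset.sum_nonneg fun r _ =>
      mul_nonneg (hq.2 r) (Finset.prod_nonneg fun i _ => pow_nonneg (hz.1 i).le _)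
  have hmin : eval x q ≤ eval y q := hx.trans_le (csInf_le hbdd ⟨y, ⟨hy0, hy1⟩, rfl⟩)
  have hterm : ∀ r ∈ q.support,
      coeff r q * ∏ i, y i ^ r i ≤ coeff r q * ∏ i, x i ^ r i ∧
      (firstDegree m r < m → coeff r q * ∏ i, y i ^ r i < coeff r q * ∏ i, x i ^ r i) := by
    intro r hr
    have hr := mem_support_iff.1 hr
    have hc : 0 < coeff r q := lt_of_le_of_ne (hq.2 r) hr.symm
    have hP : 0 < ∏ i, x i ^ r i := Finset.prod_pos fun i _ => pow_pos (hx0 i) _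
    have hs := hle r hr
    have hsum := firstDegree_add_lastDegree m hq.1 hr
    have hyr : ∏ i, y i ^ r i =
        2 ^ ((n - m) * firstDegree m r) / 2 ^ (m * lastDegree m r) * ∏ i, x i ^ r i := by
      rw [hy, prod_ite_mul_pow, inv_pow, ← pow_mul, ← pow_mul, div_eq_mul_inv]
    obtain ⟨k, rfl⟩ := Nat.exists_eq_add_of_lt hmn
    have hk : m + k + 1 - m = k + 1 := by omega
    rw [hk] at hyr
    rw [hyr]
    constructor
    · refine mul_le_mul_of_nonneg_left (mul_le_of_le_one_left hP.le ?_) hc.le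
      rw [div_le_one (by positivity)]
      refine pow_le_pow_right₀ (by norm_num) ?_
      calc (k + 1) * firstDegree m r ≤ (k + 1) * m := Nat.mul_le_mul_left _ hs
        _ = m * (k + 1) := mul_comm _ _
        _ ≤ m * lastDegree m r := Nat.mul_le_mul_left _ (by omega)
    · intro hlt
      refine mul_lt_mul_of_pos_left (mul_lt_of_lt_one_left hP ?_) hc
      rw [div_lt_one (by positivity)]
      refine pow_lt_pow_right₀ (by norm_num) ?_
      calc (k + 1) * firstDegree m r < (k + 1) * m := Nat.mul_lt_mul_of_pos_left hlt (by omega)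
        _ = m * (k + 1) := mul_comm _ _
        _ ≤ m * lastDegree m r := Nat.mul_le_mul_left _ (by omega)
  by_contra hne
  rw [eval_eq', eval_eq'] at hmin
  exact absurd hmin (not_le.2 (Finset.sum_lt_sum (fun r hr => (hterm r hr).1)
    ⟨r, mem_support_iff.2 hr, (hterm r (mem_support_iff.2 hr)).2 (lt_of_le_of_ne (hle r hr) hne)⟩))

/-! ### Nonvanishing at nonreal shifts -/

/-- `q` is homogeneous of degree `a` in the first `m` variables and of degree `b` in the others. -/
def IsBihomogeneous {n : ℕ} (m a b : ℕ) (q : MvPolynomial (Fin n) ℝ) : Prop :=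
  ∀ r, coeff r q ≠ 0 → firstDegree m r = a ∧ lastDegree m r = b

lemma IsBihomogeneous.aeval_ite_mul {n m a b : ℕ} {q : MvPolynomial (Fin n) ℝ}
    (hq : IsBihomogeneous m a b q) (α β : ℂ) (z : Fin n → ℂ) :
    aeval (fun i => if i.val < m then α * z i else β * z i) q = α ^ a * β ^ b * aeval z q := by
  rw [aeval_def, aeval_def, eval₂_eq', eval₂_eq', Finset.mul_sum]
  refine Finset.sum_congr rfl fun r hr => ?_
  obtain ⟨h1, h2⟩ := hq r (mem_support_iff.1 hr)
  rw [prod_ite_mul_pow, h1, h2]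
  ring

/-- The value is that of `q(x - t e)` at `t = -w`, and this polynomial in `t` splits over the reals.
-/
lemma IsHyperbolic.aeval_add_ne_zero {n : ℕ} (hn : n ≠ 0) {q : MvPolynomial (Fin n) ℝ}
    (hq : IsHyperbolic n q (fun _ => 1)) (x : Fin n → ℝ) {w : ℂ} (hw : w.im ≠ 0) :
    aeval (fun i => (x i : ℂ) + w) q ≠ 0 := by
  set f := onLine q (fun _ => 1) x with hf
  have hcard : Multiset.card f.roots = n := hq.2.2 x
  have hf0 : f ≠ 0 := by
    intro h
    rw [h] at hcard
    exact hn (by simpa using hcard.symm)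
  have hdeg : f.natDegree ≤ n := by
    rw [hf, onLine, aeval_def, eval₂_eq']
    refine Polynomial.natDegree_sum_le_of_forall_le _ _ fun r hr => ?_
    refine (Polynomial.natDegree_C_mul_le _ _).trans ((Polynomial.natDegree_prod_le _ _).trans ?_)
    have hr' : ∑ i, r i = n := by
      rw [← Finsupp.degree_eq_sum, Finsupp.degree_eq_weight_one]
      exact hq.1 (mem_support_iff.1 hr)
    refine (Finset.sum_le_sum fun i _ => ?_).trans_eq hr'
    have hlin : (Polynomial.C (x i) - Polynomial.X * Polynomial.C (1 : ℝ)).natDegree ≤ 1 := by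
      compute_degree
    exact Polynomial.natDegree_pow_le.trans ((Nat.mul_le_mul_left _ hlin).trans_eq (mul_one _))
  have hsplit : f.Splits := Polynomial.splits_iff_card_roots.2
    (le_antisymm (Polynomial.card_roots' f) (hcard ▸ hdeg))
  have heval : aeval (fun i => (x i : ℂ) + w) q = Polynomial.aeval (-w) f := by
    rw [hf, onLine, ← AlgHom.comp_apply, MvPolynomial.comp_aeval]
    simp
  rw [heval, hsplit.eq_prod_roots, map_mul, Polynomial.aeval_C, map_multiset_prod]
  refine mul_ne_zero (by simpa using hf0) (Multiset.prod_ne_zero ?_)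
  simp only [Multiset.map_map, Multiset.mem_map, Function.comp_apply, not_exists, not_and]
  intro a _ h
  have := congrArg Complex.im h
  simp at this
  exact hw this

/-- A bihomogeneous hyperbolic polynomial has no zero with nonreal translations in both groups
of variables. -/
lemma IsBihomogeneous.aeval_add_ite_ne_zero {n m a b : ℕ} (hn : n ≠ 0)
    {q : MvPolynomial (Fin n) ℝ} (hb : IsBihomogeneous m a b q)
    (hq : IsHyperbolic n q (fun _ => 1)) (x : Fin n → ℝ) {τ σ : ℂ} (hτ : τ.im ≠ 0)
    (hσ : σ.im ≠ 0) :
    aeval (fun i => (x i : ℂ) + if i.val < m then τ else σ) q ≠ 0 := by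
  -- Since `x + τ = τ.im * ((x + τ.re) / τ.im + I)`, and likewise for `σ`, real scalings reduce both
  -- shifts to the common shift `I`.
  have h := hb.aeval_ite_mul (τ.im : ℂ) (σ.im : ℂ) (fun i => (((if i.val < m then
    (x i + τ.re) / τ.im else (x i + σ.re) / σ.im : ℝ)) : ℂ) + Complex.I)
  have h2 : (fun i : Fin n => (x i : ℂ) + if i.val < m then τ else σ) = fun i =>
      if i.val < m then (τ.im : ℂ) * ((((if i.val < m then
        (x i + τ.re) / τ.im else (x i + σ.re) / σ.im : ℝ)) : ℂ) + Complex.I)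
      else (σ.im : ℂ) * ((((if i.val < m then
        (x i + τ.re) / τ.im else (x i + σ.re) / σ.im : ℝ)) : ℂ) + Complex.I) := by
    funext i
    split_ifs
    · apply Complex.ext <;> simp [mul_div_cancel₀, hτ]
    · apply Complex.ext <;> simp [mul_div_cancel₀, hσ]
  rw [h2, h]
  refine mul_ne_zero (mul_ne_zero (pow_ne_zero _ ?_) (pow_ne_zero _ ?_))
    (hq.aeval_add_ne_zero hn _ (by simp))
  · exact_mod_cast hτ
  · exact_mod_cast hσ

/-! ### Separation of the two groups of variables -/

/-- The values at real points of a complex polynomial with real roots all lie on one real line. -/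
lemma eval_mul_conj_eval_comm {g : Polynomial ℂ} (hg : ∀ v, g.eval v = 0 → v.im = 0) (a b : ℝ) :
    g.eval (a : ℂ) * (starRingEnd ℂ) (g.eval (b : ℂ)) =
      (starRingEnd ℂ) (g.eval (a : ℂ)) * g.eval (b : ℂ) := by
  by_cases hg0 : g = 0
  · simp [hg0]
  have key : ∀ c : ℝ, ∃ d : ℝ, g.eval (c : ℂ) = g.leadingCoeff * d := by
    intro c
    refine ⟨(g.roots.map (fun r => c - r.re)).prod, ?_⟩
    conv_lhs => rw [(IsAlgClosed.splits g).eq_prod_roots]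
    rw [Polynomial.eval_mul, Polynomial.eval_C, Polynomial.eval_multiset_prod]
    congr 1
    have : ((g.roots.map (fun r => c - r.re)).prod : ℂ) =
        (Multiset.map Complex.ofRealHom (g.roots.map (fun r => c - r.re))).prod := 
      map_multiset_prod Complex.ofRealHom _
    rw [this, Multiset.map_map, Multiset.map_map]
    congr 1
    refine Multiset.map_congr rfl fun r hr => ?_
    have := hg r ((Polynomial.mem_roots hg0).1 hr)
    apply Complex.ext <;> simp [this]
  obtain ⟨d, hd⟩ := key a
  obtain ⟨d', hd'⟩ := key b
  rw [hd, hd']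
  simp only [map_mul, Complex.conj_ofReal]
  ring

/-- The univariate polynomial `q(c X + d)`. -/
noncomputable def alongLine {n : ℕ} (q : MvPolynomial (Fin n) ℝ) (c d : Fin n → ℂ) : Polynomial ℂ :=
  aeval (fun i => Polynomial.C (c i) * Polynomial.X + Polynomial.C (d i)) q

lemma eval_alongLine {n : ℕ} (q : MvPolynomial (Fin n) ℝ) (c d : Fin n → ℂ) (v : ℂ) :
    (alongLine q c d).eval v = aeval (fun i => c i * v + d i) q := by
  rw [alongLine, ← Polynomial.coe_aeval_eq_eval]
  have : ∀ p : Polynomial ℂ, Polynomial.aeval v p = ((Polynomial.aeval v).restrictScalars ℝ) p :=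
    fun p => rfl
  rw [this, ← AlgHom.comp_apply, MvPolynomial.comp_aeval]
  simp

lemma conj_aeval {n : ℕ} (q : MvPolynomial (Fin n) ℝ) (z : Fin n → ℂ) :
    (starRingEnd ℂ) (aeval z q) = aeval (fun i => (starRingEnd ℂ) (z i)) q := by
  have : ∀ w, (starRingEnd ℂ) w = Complex.conjAe w := fun _ => rfl
  simp only [this]
  rw [← AlgHom.coe_coe, ← AlgHom.comp_apply, MvPolynomial.comp_aeval]

/-- For nonreal `t`, the values of `q(t (x - 1) + 1, ·)` at a real point and at `(1, …, 1)` lie on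
one real line. -/
lemma IsBihomogeneous.aeval_mul_conj_aeval {n m a b : ℕ} (hn : n ≠ 0)
    {q : MvPolynomial (Fin n) ℝ} (hb : IsBihomogeneous m a b q)
    (hq : IsHyperbolic n q (fun _ => 1)) (x : Fin n → ℝ) {t : ℂ} (ht : t.im ≠ 0) :
    aeval (fun i => if i.val < m then t * (x i - 1) + 1 else (x i : ℂ)) q *
      (starRingEnd ℂ) (aeval (fun i => if i.val < m then t * (x i - 1) + 1 else (1 : ℂ)) q) =
    (starRingEnd ℂ) (aeval (fun i => if i.val < m then t * (x i - 1) + 1 else (x i : ℂ)) q) *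
      aeval (fun i => if i.val < m then t * (x i - 1) + 1 else (1 : ℂ)) q := by
  have him : ∀ v : ℂ, v.im ≠ 0 → v⁻¹.im ≠ 0 := by
    intro v hv
    have hv0 : v ≠ 0 := by rintro rfl; simp at hv
    rw [Complex.inv_im]
    exact div_ne_zero (neg_ne_zero.2 hv) (by simpa using hv0)
  -- In `v`, take `q(t (x' - 1) + 1, v (x'' - 1) + 1)`, evaluated at `1` and `0`. A nonreal root `v`
  -- is excluded by dividing the groups by `t` and `v`, which leaves the nonreal shifts `t⁻¹` and
  -- `v⁻¹`.
  have h := eval_mul_conj_eval_comm (g := alongLine q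
    (fun i => if i.val < m then 0 else (x i : ℂ) - 1)
    (fun i => if i.val < m then t * (x i - 1) + 1 else 1)) ?_ 1 0
  · simp only [eval_alongLine] at h
    convert h using 6 <;> · split_ifs <;> simp
  · intro v hv
    by_contra hvim
    have ht0 : t ≠ 0 := by rintro rfl; simp at ht
    have hv0 : v ≠ 0 := by rintro rfl; simp at hvim
    rw [eval_alongLine] at hv
    have h1 := hb.aeval_ite_mul t v
      (fun i => ((x i - 1 : ℝ) : ℂ) + if i.val < m then t⁻¹ else v⁻¹)
    have h2 : (fun i : Fin n => (if i.val < m then 0 else (x i : ℂ) - 1) * v +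
        if i.val < m then t * (x i - 1) + 1 else 1) = fun i => if i.val < m then
          t * (((x i - 1 : ℝ) : ℂ) + if i.val < m then t⁻¹ else v⁻¹) else
          v * (((x i - 1 : ℝ) : ℂ) + if i.val < m then t⁻¹ else v⁻¹) := by
      funext i
      split_ifs
      · push_cast; field_simp; ring
      · push_cast; field_simp
    rw [h2, h1] at hv
    exact mul_ne_zero (mul_ne_zero (pow_ne_zero _ ht0) (pow_ne_zero _ hv0))
      (hb.aeval_add_ite_ne_zero hn hq _ (him t ht) (him v hvim)) hv

/-- A bihomogeneous hyperbolic polynomial separates its two groups of variables. -/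
lemma IsBihomogeneous.eval_mul_eval_one {n m a b : ℕ} (hn : n ≠ 0)
    {q : MvPolynomial (Fin n) ℝ} (hb : IsBihomogeneous m a b q)
    (hq : IsHyperbolic n q (fun _ => 1)) (x : Fin n → ℝ) :
    eval x q * eval (fun _ => 1) q =
      eval (fun i => if i.val < m then x i else 1) q *
        eval (fun i => if i.val < m then 1 else x i) q := by
  set A : ℂ → ℂ := fun t =>
    aeval (fun i => if i.val < m then t * (x i - 1) + 1 else (x i : ℂ)) q with hA
  set B : ℂ → ℂ := fun t =>
    aeval (fun i => if i.val < m then t * (x i - 1) + 1 else (1 : ℂ)) q with hB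
  have hAconj : ∀ t, (starRingEnd ℂ) (A t) = A ((starRingEnd ℂ) t) := by
    intro t
    simp only [hA, conj_aeval]
    congr 2
    funext i
    split_ifs <;> simp
  have hBconj : ∀ t, (starRingEnd ℂ) (B t) = B ((starRingEnd ℂ) t) := by
    intro t
    simp only [hB, conj_aeval]
    congr 2
    funext i
    split_ifs <;> simp
  have hpoly : ∀ c : ℂ, ∃ P Q : Polynomial ℂ, ∀ v, P.eval v = A (1 / 2 + c * v) ∧
      Q.eval v = B (1 / 2 + c * v) := by
    intro c
    refine ⟨alongLine q (fun i => if i.val < m then c * (x i - 1) else 0)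
        (fun i => if i.val < m then 1 / 2 * (x i - 1) + 1 else x i),
      alongLine q (fun i => if i.val < m then c * (x i - 1) else 0)
        (fun i => if i.val < m then 1 / 2 * (x i - 1) + 1 else 1), fun v => ⟨?_, ?_⟩⟩
    all_goals
      rw [eval_alongLine]
      simp only [hA, hB]
      congr 2
      funext i
      split_ifs <;> ring
  -- On the line `Re t = 1/2` conjugation is `t ↦ 1 - t`, so the relation there becomes the
  -- polynomial identity `A(t) B(1 - t) = A(1 - t) B(t)`.
  obtain ⟨P₁, Q₁, h₁⟩ := hpoly Complex.I
  obtain ⟨P₂, Q₂, h₂⟩ := hpoly (-Complex.I)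
  have hzero : P₁ * Q₂ - P₂ * Q₁ = 0 := by
    refine Polynomial.eq_zero_of_infinite_isRoot _
      (((Set.Ioi_infinite (0 : ℝ)).image Complex.ofReal_injective.injOn).mono ?_)
    rintro _ ⟨v, hv, rfl⟩
    have hv : v ≠ 0 := ne_of_gt hv
    have hc : (starRingEnd ℂ) (1 / 2 + Complex.I * v) = 1 / 2 + -Complex.I * v := by
      apply Complex.ext <;> simp
    have h := hb.aeval_mul_conj_aeval hn hq x (t := 1 / 2 + Complex.I * v) (by simpa using hv)
    change A _ * (starRingEnd ℂ) (B _) = (starRingEnd ℂ) (A _) * B _ at h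
    rw [hAconj, hBconj, hc] at h
    change Polynomial.eval (v : ℂ) (P₁ * Q₂ - P₂ * Q₁) = 0
    rw [Polynomial.eval_sub, Polynomial.eval_mul, Polynomial.eval_mul, (h₁ v).1, (h₁ v).2,
      (h₂ v).1, (h₂ v).2, h, sub_self]
  -- This value of the parameter gives `t = 1`.
  have hfin := congrArg (Polynomial.eval (-Complex.I / 2)) hzero
  rw [Polynomial.eval_sub, Polynomial.eval_mul, Polynomial.eval_mul, (h₁ _).1, (h₁ _).2, (h₂ _).1,
    (h₂ _).2, Polynomial.eval_zero, sub_eq_zero] at hfin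
  have e1 : 1 / 2 + Complex.I * (-Complex.I / 2) = 1 := by
    linear_combination (-1 / 2 : ℂ) * Complex.I_mul_I
  have e2 : 1 / 2 + -Complex.I * (-Complex.I / 2) = 0 := by
    linear_combination (1 / 2 : ℂ) * Complex.I_mul_I
  rw [e1, e2] at hfin
  have hreal : ∀ y : Fin n → ℝ, ((eval y q : ℝ) : ℂ) = aeval (fun i => (y i : ℂ)) q := by
    intro y
    have := MvPolynomial.aeval_algebraMap_apply ℂ y q
    rw [aeval_eq_eval] at this
    exact this.symm
  have hA1 : A 1 = (eval x q : ℝ) := by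
    simp [hA, hreal]
  have hB0 : B 0 = (eval (fun _ => 1) q : ℝ) := by
    simp [hB, hreal]
  have hA0 : A 0 = (eval (fun i => if i.val < m then 1 else x i) q : ℝ) := by
    rw [hreal]; simp [hA, apply_ite Complex.ofReal]
  have hB1 : B 1 = (eval (fun i => if i.val < m then x i else 1) q : ℝ) := by
    rw [hreal]; simp [hB, apply_ite Complex.ofReal]
  rw [hA1, hB0, hA0, hB1] at hfin
  rw [mul_comm (eval (fun i => if i.val < m then x i else 1) q)]
  exact_mod_cast hfin

/-! ### Substitutions and the two factors -/

lemma coeff_mul_nonneg {σ : Type*} {p q : MvPolynomial σ ℝ} (hp : ∀ r, 0 ≤ coeff r p)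
    (hq : ∀ r, 0 ≤ coeff r q) (r : σ →₀ ℕ) : 0 ≤ coeff r (p * q) := by
  classical
  rw [coeff_mul]
  exact Finset.sum_nonneg fun x _ => mul_nonneg (hp _) (hq _)

lemma coeff_one_nonneg {σ : Type*} (r : σ →₀ ℕ) : 0 ≤ coeff r (1 : MvPolynomial σ ℝ) := by
  classical
  rw [coeff_one]
  split_ifs <;> norm_num

/-- Substituting polynomials with nonnegative coefficients preserves nonnegative coefficients. -/
lemma coeff_aeval_nonneg {σ τ : Type*} [Fintype σ] {q : MvPolynomial σ ℝ}
    (hq : ∀ r, 0 ≤ coeff r q) {f : σ → MvPolynomial τ ℝ} (hf : ∀ i r, 0 ≤ coeff r (f i))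
    (r : τ →₀ ℕ) : 0 ≤ coeff r (aeval f q) := by
  classical
  rw [aeval_def, eval₂_eq', coeff_sum]
  refine Finset.sum_nonneg fun d _ => ?_
  rw [algebraMap_eq, coeff_C_mul]
  refine mul_nonneg (hq d) ?_
  revert r
  refine Finset.prod_induction _ (fun p : MvPolynomial τ ℝ => ∀ r, 0 ≤ coeff r p)
    (fun _ _ => coeff_mul_nonneg) coeff_one_nonneg fun i _ => ?_
  generalize d i = k
  induction k with
  | zero => simpa using coeff_one_nonneg
  | succ k ih =>
    rw [pow_succ]
    exact coeff_mul_nonneg ih (hf i)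

/-- The weights let a variable specialized to `1` count with degree `0`. -/
lemma isHomogeneous_aeval {n k d : ℕ} {q : MvPolynomial (Fin n) ℝ}
    {f : Fin n → MvPolynomial (Fin k) ℝ} {w : Fin n → ℕ} (hf : ∀ i, (f i).IsHomogeneous (w i))
    (hq : ∀ r, coeff r q ≠ 0 → ∑ i, w i * r i = d) : (aeval f q).IsHomogeneous d := by
  rw [aeval_def, eval₂_eq']
  refine IsHomogeneous.sum _ _ _ fun r hr => ?_
  rw [← hq r (mem_support_iff.1 hr), algebraMap_eq]
  exact (IsHomogeneous.prod _ _ _ fun i _ => (hf i).pow (r i)).C_mul _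

lemma coeff_X_nonneg {σ : Type*} (i : σ) (r : σ →₀ ℕ) : 0 ≤ coeff r (X i : MvPolynomial σ ℝ) := by
  classical
  rw [coeff_X]
  split_ifs <;> norm_num

end HyperbolicPoly

theorem theoremD1 (n m : ℕ) (hmn : m < n) (q : MvPolynomial (Fin n) ℝ)
    (hq : q ∈ HyperbolicPoly.HomPlus n n)
    (hpos : HyperbolicPoly.IsPOSHyperbolic n q)
    (hcap : HyperbolicPoly.CapAttained q)
    (hrank : HyperbolicPoly.rank q (HyperbolicPoly.firstBasisSum n m) = m) :
    ∃ q₁ ∈ HyperbolicPoly.HomPlus m m, ∃ q₂ ∈ HyperbolicPoly.HomPlus (n - m) (n - m),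
      q = HyperbolicPoly.inFirstVars hmn q₁ * HyperbolicPoly.inLastVars hmn q₂ := by
  open HyperbolicPoly MvPolynomial in
  have hb : IsBihomogeneous m m (n - m) q := by
    intro r hr
    have h1 := firstDegree_eq_of_capAttained hmn hq hcap
      (fun r hr => firstDegree_le_rank hmn hq hpos.2.1 hrank hr) hr
    have h2 := firstDegree_add_lastDegree m hq.1 hr
    exact ⟨h1, by omega⟩
  have hone := hpos.1
  set f₁ : Fin n → MvPolynomial (Fin m) ℝ := fun i =>
    if h : i.val < m then MvPolynomial.X ⟨i.val, h⟩ else 1 with hf₁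
  set f₂ : Fin n → MvPolynomial (Fin (n - m)) ℝ := fun i =>
    if h : i.val < m then 1 else MvPolynomial.X ⟨i.val - m, by omega⟩ with hf₂
  -- The factors are `q(x', 1)` and `q(1, x'') / q(e)`.
  refine ⟨MvPolynomial.aeval f₁ q, ⟨?_, ?_⟩,
    MvPolynomial.C (MvPolynomial.eval (fun _ => (1 : ℝ)) q)⁻¹ * MvPolynomial.aeval f₂ q,
    ⟨?_, ?_⟩, ?_⟩
  · refine HyperbolicPoly.isHomogeneous_aeval (w := fun i => if i.val < m then 1 else 0) ?_ ?_
    · intro i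
      simp only [hf₁]
      split_ifs
      · exact MvPolynomial.isHomogeneous_X _ _
      · exact MvPolynomial.isHomogeneous_one _ _
    · intro r hr
      simp only [ite_mul, one_mul, zero_mul, ← Finset.sum_filter]
      exact (hb r hr).1
  · refine HyperbolicPoly.coeff_aeval_nonneg hq.2 fun i r => ?_
    simp only [hf₁]
    split_ifs
    · exact HyperbolicPoly.coeff_X_nonneg _ _
    · exact HyperbolicPoly.coeff_one_nonneg _
  · refine MvPolynomial.IsHomogeneous.C_mul ?_ _
    refine HyperbolicPoly.isHomogeneous_aeval (w := fun i => if ¬ i.val < m then 1 else 0) ?_ ?_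
    · intro i
      simp only [hf₂]
      split_ifs
      · exact MvPolynomial.isHomogeneous_one _ _
      · exact MvPolynomial.isHomogeneous_X _ _
    · intro r hr
      simp only [ite_mul, one_mul, zero_mul, ← Finset.sum_filter]
      exact (hb r hr).2
  · intro r
    rw [MvPolynomial.coeff_C_mul]
    refine mul_nonneg (inv_nonneg.2 hone.le)
      (HyperbolicPoly.coeff_aeval_nonneg hq.2 (fun i r => ?_) r)
    simp only [hf₂]
    split_ifs
    · exact HyperbolicPoly.coeff_one_nonneg _
    · exact HyperbolicPoly.coeff_X_nonneg _ _
  · refine MvPolynomial.funext fun x => ?_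
    have key := hb.eval_mul_eval_one (by omega) hpos.2.1 x
    have hsub : ∀ {k : ℕ} (f : Fin n → MvPolynomial (Fin k) ℝ) (y : Fin k → ℝ),
        MvPolynomial.eval y (MvPolynomial.aeval f q) =
          MvPolynomial.eval (fun i => MvPolynomial.eval y (f i)) q := by
      intro k f y
      rw [MvPolynomial.aeval_def, MvPolynomial.eval₂_eq', MvPolynomial.eval_eq' _ q]
      simp only [map_sum, map_mul, map_prod, map_pow, MvPolynomial.algebraMap_eq,
        MvPolynomial.eval_C]
    rw [map_mul, HyperbolicPoly.inFirstVars, HyperbolicPoly.inLastVars, MvPolynomial.eval_rename,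
      MvPolynomial.eval_rename, map_mul, MvPolynomial.eval_C, hsub, hsub]
    have e1 : (fun i => MvPolynomial.eval
        (x ∘ fun i : Fin m => (⟨i.val, i.isLt.trans hmn⟩ : Fin n)) (f₁ i)) =
        fun i => if i.val < m then x i else 1 := by
      funext i
      simp only [hf₁]
      split_ifs <;> simp
    have e2 : (fun i => MvPolynomial.eval
        (x ∘ fun j : Fin (n - m) => (⟨m + j.val,
          (Nat.add_lt_add_left j.isLt m).trans_eq (Nat.add_sub_of_le hmn.le)⟩ : Fin n)) (f₂ i)) =
        fun i => if i.val < m then 1 else x i := by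
      funext i
      simp only [hf₂]
      split_ifs with h
      · simp
      · simp only [MvPolynomial.eval_X, Function.comp_apply]
        congr 1
        ext
        simp only
        omega
    rw [e1, e2]
    have hne := hone.ne'
    field_simp
    linarith
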